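/- Let $n\ge 1$ and let $H\in\mathbb{R}^{n\times n}$ be a positive semi-definite Hankel matrix (that is, $H_{ij}$ depends only on $i+j$) with $\operatorname{rank}(H)=r$. For $0\le k\le n$ write $H(1{:}k,1{:}k)$ for the leading $k\times k$ principal submatrix of $H$; the empty matrix ($k=0$) counts as positive definite. (a) If the last column $H(:,n)$ is linearly dependent on the first $n-1$ columns, i.e. it lies in the linear span of $H(:,1),\dots,H(:,n-1)$ (for $n=1$: it is zero), then the leading $r\times r$ principal submatrix $H(1{:}r,1{:}r)$ is positive definite. (b) If $H(:,n)$ does not lie in the linear span of $H(:,1),\dots,H(:,n-1)$, then $r\ge 1$ and the leading $(r-1)\times(r-1)$ principal submatrix $H(1{:}r-1,1{:}r-1)$ is positive definite. -/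

import Mathlib

/-- A square real matrix is a Hankel matrix if its entries depend only on the sum of the (zero-based)
indices: `H i j = h (i + j)` for a generating sequence `h`. Only the values `h 0, …, h (2 * n - 2)`
matter, so this sequence stands for a generating vector of length `2 * n - 1`. -/
def IsHankel {n : ℕ} (H : Matrix (Fin n) (Fin n) ℝ) : Prop :=
  ∃ h : ℕ → ℝ, ∀ i j : Fin n, H i j = h ((i : ℕ) + (j : ℕ))

/-- The leading `k × k` principal submatrix `H(1:k, 1:k)`. -/
def leadingPrincipal {n : ℕ} (H : Matrix (Fin n) (Fin n) ℝ) (k : ℕ) (hk : k ≤ n) :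
    Matrix (Fin k) (Fin k) ℝ :=
  H.submatrix (Fin.castLE hk) (Fin.castLE hk)

/-- The last column of `H` is linearly dependent on the first `n - 1` columns, that is, it is a
linear combination of them (for `n = 1`: it is zero). -/
def LastColDependent {n : ℕ} (hn : 0 < n) (H : Matrix (Fin n) (Fin n) ℝ) : Prop :=
  H.col ⟨n - 1, Nat.sub_lt hn Nat.one_pos⟩ ∈
    Submodule.span ℝ (H.col '' {j : Fin n | (j : ℕ) < n - 1})

/-! Let `k` be the first position that ends a kernel vector, or `n` if there is none. A null vector
of a leading block of size at most `k`, padded by zeros, would be a kernel vector ending earlier, so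
these blocks are positive definite. Kernel vectors can be shifted right up to position `n - 2`, so
every column but the last lies in the span of the first `k`. Hence `r ≤ k` in case (a) and `r ≤ k +
1` in case (b). -/

open Matrix in
/-- There is a kernel vector of `H` whose last nonzero entry is a `1` in position `j`. -/
def HasMonicKernelVector {n : ℕ} (H : Matrix (Fin n) (Fin n) ℝ) (j : ℕ) : Prop :=
  ∃ y : ℕ → ℝ, y j = 1 ∧ (∀ i, j < i → y i = 0) ∧ H *ᵥ (fun a : Fin n => y a) = 0

open Matrix in
/-- The kernel vectors of a positive semidefinite Hankel matrix can be shifted. -/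
theorem HasMonicKernelVector.succ {n j : ℕ} {H : Matrix (Fin n) (Fin n) ℝ}
    (hHankel : IsHankel H) (hpsd : H.PosSemidef) (hj : j + 2 < n)
    (hv : HasMonicKernelVector H j) : HasMonicKernelVector H (j + 1) := by
  obtain ⟨h, hh⟩ := hHankel
  obtain ⟨y, hy1, hy0, hker⟩ := hv
  let z : ℕ → ℝ := fun a => if a = 0 then 0 else y (a - 1)
  have hz0 : ∀ i, j + 1 < i → z i = 0 := by
    intro i hi
    simp only [z]
    rw [if_neg (by omega)]
    exact hy0 _ (by omega)
  refine ⟨z, by simp [z, hy1], hz0, ?_⟩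
  -- By the Hankel structure, entry `i` of `H z` is entry `i + 1` of `H y`; only the last row
  -- escapes.
  have key : ∀ i : Fin n, (i : ℕ) + 1 < n → (H *ᵥ (fun a : Fin n => z a)) i = 0 := by
    intro i hi
    have h1 := congrFun hker ⟨i + 1, hi⟩
    obtain ⟨m, rfl⟩ : ∃ m, n = m + 1 := ⟨n - 1, by omega⟩
    simp only [mulVec, dotProduct, hh, Pi.zero_apply] at h1 ⊢
    rw [Fin.sum_univ_castSucc] at h1
    rw [Fin.sum_univ_succ]
    have hm : y m = 0 := hy0 m (by omega)
    simp only [Fin.val_castSucc, Fin.val_last, hm, mul_zero, add_zero] at h1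
    simp only [z, Fin.val_zero, Fin.val_succ, if_true, mul_zero, zero_add, Nat.succ_ne_zero,
      if_false, Nat.add_sub_cancel]
    rw [← h1]
    refine Finset.sum_congr rfl fun a _ => ?_
    rw [show (i : ℕ) + (a + 1) = i + 1 + a by ring]
  -- Since `j + 1 < n - 1`, `z` vanishes in that last row, so its quadratic form is zero;
  -- semidefiniteness then gives `H z = 0`.
  rw [← hpsd.dotProduct_mulVec_zero_iff]
  refine Finset.sum_eq_zero fun i _ => ?_
  by_cases hi : (i : ℕ) + 1 < n
  · rw [key i hi, mul_zero]
  · simp [hz0 i (by omega)]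

open Matrix in
/-- A leading principal submatrix of a positive semidefinite matrix is positive definite if its
columns are not linearly dependent on the preceding ones. -/
theorem posDef_leadingPrincipal {n k : ℕ} {H : Matrix (Fin n) (Fin n) ℝ}
    (hpsd : H.PosSemidef) (hk : k ≤ n) (hmin : ∀ j < k, ¬ HasMonicKernelVector H j) :
    (leadingPrincipal H k hk).PosDef := by
  have hsub : (leadingPrincipal H k hk).PosSemidef := hpsd.submatrix _
  refine PosDef.of_dotProduct_mulVec_pos hsub.1 fun x hx => ?_
  refine lt_of_le_of_ne (hsub.dotProduct_mulVec_nonneg x) fun h0 => ?_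
  let y : ℕ → ℝ := fun a => if ha : a < k then x ⟨a, ha⟩ else 0
  have hyk : ∀ i : Fin k, y i = x i := fun i => by simp [y]
  have hsum : ∀ f : Fin n → ℝ, (∀ a : Fin n, k ≤ (a : ℕ) → f a = 0) →
      ∑ a, f a = ∑ a : Fin k, f (Fin.castLE hk a) := by
    intro f hf
    symm
    refine Finset.sum_of_injOn (Fin.castLE hk) (Fin.castLE_injective hk).injOn (by simp) ?_
      (fun _ _ => rfl)
    intro a _ ha
    refine hf a (not_lt.1 fun hak => ha ?_)
    exact ⟨⟨a, hak⟩, by simp, rfl⟩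
  have hy0 : ∀ a : ℕ, k ≤ a → y a = 0 := fun a ha => by simp [y, not_lt.2 ha]
  have hker : H *ᵥ (fun a : Fin n => y a) = 0 := by
    rw [← hpsd.dotProduct_mulVec_zero_iff, h0]
    simp only [dotProduct, mulVec, star_trivial, Pi.star_apply]
    rw [hsum _ fun a ha => by rw [hy0 a ha, zero_mul]]
    refine Finset.sum_congr rfl fun i _ => ?_
    rw [hsum _ fun a ha => by rw [hy0 a ha, mul_zero]]
    simp [hyk, leadingPrincipal]
  obtain ⟨i, hi⟩ := Function.ne_iff.1 hx
  have hne : y i ≠ 0 := by simpa [hyk] using hi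
  have hlast : y (Nat.findGreatest (fun a => y a ≠ 0) k) ≠ 0 :=
    Nat.findGreatest_spec (P := fun a => y a ≠ 0) i.2.le hne
  -- Scaling by the last nonzero entry makes the padded vector monic at `j < k`.
  set j := Nat.findGreatest (fun a => y a ≠ 0) k with hjdef
  have hjk : j < k := not_le.1 fun h => hlast (hy0 j h)
  refine hmin j hjk ⟨fun a => (y j)⁻¹ * y a, inv_mul_cancel₀ hlast, fun a ha => ?_, ?_⟩
  · by_cases hak : a ≤ k
    · have := Nat.findGreatest_is_greatest ha hak
      simp only [not_not] at this
      simp [this]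
    · simp [hy0 a (by omega)]
  · have : (fun a : Fin n => (y j)⁻¹ * y a) = (y j)⁻¹ • (fun a : Fin n => y a) := rfl
    rw [this, mulVec_smul, hker, smul_zero]

open Matrix in
theorem HasMonicKernelVector.col_mem {n : ℕ} {H : Matrix (Fin n) (Fin n) ℝ} {j : Fin n}
    (hv : HasMonicKernelVector H j) {W : Submodule ℝ (Fin n → ℝ)}
    (hW : ∀ a : Fin n, a < j → H.col a ∈ W) : H.col j ∈ W := by
  obtain ⟨y, hy1, hy0, hker⟩ := hv
  have hsum : ∑ a : Fin n, y a • H.col a = 0 := by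
    rw [← hker]
    ext i
    simp [mulVec, dotProduct, mul_comm]
  rw [← Finset.add_sum_erase _ _ (Finset.mem_univ j), hy1, one_smul] at hsum
  rw [eq_neg_of_add_eq_zero_left hsum]
  refine W.neg_mem (W.sum_mem fun a ha => ?_)
  rcases lt_or_gt_of_ne (Finset.ne_of_mem_erase ha) with h | h
  · exact W.smul_mem _ (hW a h)
  · rw [hy0 a h, zero_smul]
    exact W.zero_mem

open Matrix in
/-- If column `k` of a positive semidefinite Hankel matrix depends on the preceding ones, then all
columns but the last lie in the span of the first `k`. -/
theorem col_mem_span_of_hasMonicKernelVector {n k : ℕ} {H : Matrix (Fin n) (Fin n) ℝ}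
    (hHankel : IsHankel H) (hpsd : H.PosSemidef) (hv : k < n → HasMonicKernelVector H k)
    (hk : k ≤ n) (j : Fin n) (hj : (j : ℕ) < n - 1) :
    H.col j ∈ Submodule.span ℝ (Set.range fun i : Fin k => H.col (Fin.castLE hk i)) := by
  obtain ⟨j, hjn⟩ := j
  induction j using Nat.strong_induction_on with
  | _ j ih =>
    by_cases hjk : j < k
    · exact Submodule.subset_span ⟨⟨j, hjk⟩, rfl⟩
    · have hall : ∀ m, k ≤ m → m < n - 1 → HasMonicKernelVector H m := by
        intro m hm
        induction m, hm using Nat.le_induction with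
        | base => exact fun h => hv (by omega)
        | succ m hm ihm => exact fun h => (ihm (by omega)).succ hHankel hpsd (by omega)
      refine HasMonicKernelVector.col_mem (j := ⟨j, hjn⟩) (hall j (by omega) hj) fun a ha => ?_
      have ha' : (a : ℕ) < j := ha
      have hj' : j < n - 1 := hj
      exact ih a ha' a.2 (by simpa using ha'.trans hj')

open Matrix in
theorem mainTheorem6 (n r : ℕ) (hn : 0 < n) (H : Matrix (Fin n) (Fin n) ℝ)
    (hHankel : IsHankel H) (hpsd : H.PosSemidef) (hrank : H.rank = r) :
    (LastColDependent hn H →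
      ∃ hrn : r ≤ n, (leadingPrincipal H r hrn).PosDef) ∧
    (¬ LastColDependent hn H →
      1 ≤ r ∧ ∃ hrn : r - 1 ≤ n, (leadingPrincipal H (r - 1) hrn).PosDef) := by
  classical
  have hrn : r ≤ n := by simpa [hrank] using H.rank_le_width
  obtain ⟨k, hk, hv, hmin⟩ : ∃ k, k ≤ n ∧ (k < n → HasMonicKernelVector H k) ∧
      ∀ j < k, ¬ HasMonicKernelVector H j := by
    have hex : ∃ k, k = n ∨ HasMonicKernelVector H k := ⟨n, Or.inl rfl⟩
    refine ⟨Nat.find hex, Nat.find_min' hex (Or.inl rfl), fun h => ?_, fun j hj hvj => ?_⟩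
    · exact (Nat.find_spec hex).resolve_left h.ne
    · exact Nat.find_min hex hj (Or.inr hvj)
  set W := Submodule.span ℝ (Set.range fun i : Fin k => H.col (Fin.castLE hk i))
  have hWk : Module.finrank ℝ W ≤ k := by
    have h := finrank_range_le_card (R := ℝ) (fun i : Fin k => H.col (Fin.castLE hk i))
    rwa [Fintype.card_fin] at h
  have hcol := col_mem_span_of_hasMonicKernelVector hHankel hpsd hv hk
  rw [rank_eq_finrank_span_cols] at hrank
  set c := H.col ⟨n - 1, Nat.sub_lt hn Nat.one_pos⟩ with hc
  have hcases : ∀ j : Fin n, (j : ℕ) < n - 1 ∨ H.col j = c := by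
    intro j
    by_cases hj : (j : ℕ) < n - 1
    · exact Or.inl hj
    · have : j = ⟨n - 1, Nat.sub_lt hn Nat.one_pos⟩ := Fin.ext (by simp; omega)
      exact Or.inr (by rw [this])
  constructor
  · intro hdep
    refine ⟨hrn, posDef_leadingPrincipal hpsd hrn fun j hj => hmin j (hj.trans_le ?_)⟩
    have hcW : c ∈ W := by
      refine Submodule.span_le.2 ?_ hdep
      rintro _ ⟨j, hj, rfl⟩
      exact hcol j hj
    rw [← hrank]
    refine (Submodule.finrank_mono (Submodule.span_le.2 ?_)).trans hWk
    rintro _ ⟨j, rfl⟩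
    rcases hcases j with hj | hj
    · exact hcol j hj
    · rw [hj]
      exact hcW
  · intro hdep
    have hc0 : c ≠ 0 := fun h => hdep (by
      unfold LastColDependent
      rw [← hc, h]
      exact Submodule.zero_mem _)
    have hle : r ≤ k + 1 := by
      rw [← hrank]
      have hsup : Submodule.span ℝ (Set.range H.col) ≤ W ⊔ Submodule.span ℝ {c} := by
        refine Submodule.span_le.2 ?_
        rintro _ ⟨j, rfl⟩
        rcases hcases j with hj | hj
        · exact Submodule.mem_sup_left (hcol j hj)
        · rw [hj]
          exact Submodule.mem_sup_right (Submodule.mem_span_singleton_self c)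
      have h1 := Submodule.finrank_mono hsup
      have h2 := Submodule.finrank_add_le_finrank_add_finrank W (Submodule.span ℝ {c})
      rw [finrank_span_singleton hc0] at h2
      omega
    refine ⟨?_, by omega, posDef_leadingPrincipal hpsd _ fun j hj => hmin j (by omega)⟩
    by_contra hr
    have h0 : Submodule.span ℝ (Set.range H.col) = ⊥ := by
      rw [← Submodule.finrank_eq_zero (R := ℝ)]
      omega
    exact hc0 ((Submodule.mem_bot ℝ).1 (h0 ▸ Submodule.subset_span ⟨_, rfl⟩))
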